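/- Let $F$ be an algebraically closed field, let $n\ge 2$, and let $E$ be a $2n$-dimensional $F$-vector space with a symplectic (nondegenerate alternating bilinear) form $\langle\,,\rangle$. Let $e_1,\dots,e_{2n}$ be a basis of $E$ such that, for $i<j$, $\langle e_i,e_j\rangle=1$ if $i+j=2n+1$ and $\langle e_i,e_j\rangle=0$ otherwise. For $\ell\le m$ let $I(\ell,m)$ be the set of tuples $1\le\alpha_1<\dots<\alpha_\ell\le m$ (for $\ell=0$ only the empty tuple). Use the vectors $e_\alpha=e_{\alpha_1}\wedge\dots\wedge e_{\alpha_n}$, $\alpha\in I(n,2n)$, as a basis of $\bigwedge^nE$, let $X_\alpha$ be the corresponding homogeneous coordinates on $\mathbb P(\bigwedge^nE)$, and let $R=F[X_\alpha:\alpha\in I(n,2n)]$. For an arbitrary tuple $c\in\{1,\dots,2n\}^n$ let $X_c\in R$ be $0$ if $c$ has a repeated entry, and otherwise the sign of the permutation sorting $c$ times the variable of the sorted tuple. For $\alpha\in I(n-1,2n)$ and $\beta\in I(n+1,2n)$ put $$Q_{\alpha,\beta}=\sum_{i=1}^{n+1}(-1)^i X_{\alpha_1\cdots\alpha_{n-1}\beta_i}\,X_{\beta_1\cdots\widehat{\beta_i}\cdots\beta_{n+1}},$$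 and for $\gamma\in I(n-2,2n)$ put $$\Pi_\gamma=\sum_{i=1}^n c_{i,\gamma}\,X_{i,\gamma_1,\dots,\gamma_{n-2},2n-i+1},$$ where $c_{i,\gamma}=1$ if the entries $i,\gamma_1,\dots,\gamma_{n-2},2n-i+1$ are distinct and $c_{i,\gamma}=0$ otherwise. Let $L(n,E)\subseteq\mathbb P(\bigwedge^nE)$ be the Lagrangian-Grassmannian in its Plücker embedding, that is, the set of the points $[w_1\wedge\dots\wedge w_n]$ where $w_1,\dots,w_n$ is a basis of an $n$-dimensional isotropic subspace of $E$, and let $I(L(n,E))\subseteq R$ be its vanishing ideal, the ideal generated by the homogeneous polynomials that vanish on $L(n,E)$. Then $$I(L(n,E))=\sqrt{\big\langle Q_{\alpha,\beta},\ \Pi_\gamma \;:\; \alpha\in I(n-1,2n),\ \beta\in I(n+1,2n),\ \gamma\in I(n-2,2n)\big\rangle},$$ and $L(n,E)$ is a projective variety, i.e. a nonempty irreducible set that is the set of common zeros in $\mathbb P(\bigwedge^nE)$ of a set of homogeneous polynomials. -/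

import Mathlib

noncomputable section

namespace LagrangianGrassmannian

open Module Set
open scoped LinearAlgebra.Projectivization

section Projective

variable {F V σ : Type*} [Field F] [AddCommGroup V] [Module F V]

/-- The set of zeros in `ℙ(V)` of a set `T` of (homogeneous) polynomials in the homogeneous
coordinates given by the basis `b` of `V`. -/
def projZeroLocus (b : Basis σ F V) (T : Set (MvPolynomial σ F)) : Set (ℙ F V) :=
  {p | ∀ f ∈ T, MvPolynomial.eval (fun s => b.repr p.rep s) f = 0}

/-- A projective algebraic set: the set of common zeros of a set of homogeneous polynomials. -/
def IsProjAlgebraicSet (b : Basis σ F V) (S : Set (ℙ F V)) : Prop :=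
  ∃ T : Set (MvPolynomial σ F),
    (∀ f ∈ T, ∃ d, MvPolynomial.IsHomogeneous f d) ∧ S = projZeroLocus b T

/-- A projective variety: a projective algebraic set that is irreducible, i.e. nonempty and not
covered by two algebraic sets neither of which contains it. -/
def IsProjVariety (b : Basis σ F V) (S : Set (ℙ F V)) : Prop :=
  IsProjAlgebraicSet b S ∧ S.Nonempty ∧
    ∀ Y Z : Set (ℙ F V), IsProjAlgebraicSet b Y → IsProjAlgebraicSet b Z →
      S ⊆ Y ∪ Z → S ⊆ Y ∨ S ⊆ Z

/-- The homogeneous vanishing ideal `I(S)` of a subset `S` of `ℙ(V)`: the ideal generated by the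
homogeneous polynomials that vanish at every point of `S`. -/
def projVanishingIdeal (b : Basis σ F V) (S : Set (ℙ F V)) : Ideal (MvPolynomial σ F) :=
  Ideal.span {f | (∃ d, MvPolynomial.IsHomogeneous f d) ∧
    ∀ p ∈ S, MvPolynomial.eval (fun s => b.repr p.rep s) f = 0}

end Projective

section Plucker

variable (F : Type*) [Field F] {n m : ℕ}

/-- The Plücker variable `X_c` attached to an arbitrary tuple `c = (c₁, …, cₙ)` of indices, with
the usual convention: `X_c` is alternating in `c`, so it is `0` if an index is repeated, and
otherwise it is the sign of the permutation that sorts `c`, times the variable of the underlying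
set of `c`. The variables are indexed by the `n`-element subsets of `{1, …, m}`, that is, by the
strictly increasing tuples. -/
def pluckerVar (c : Fin n → Fin m) : MvPolynomial (powersetCard (Fin m) n) F :=
  if hc : Function.Injective c then
    MvPolynomial.C (((Equiv.Perm.sign (Tuple.sort c) : ℤˣ) : ℤ) : F) *
      MvPolynomial.X (powersetCard.ofFinEmb n (Fin m) ⟨c, hc⟩)
  else 0

/-- The quadratic Plücker relation
`Q_{α,β} = ∑_{i=1}^{n+1} (-1)^i X_{α₁⋯α_{n-1}β_i} X_{β₁⋯β̂_i⋯β_{n+1}}`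
for increasing tuples `α` of length `k = n - 1` and `β` of length `n + 1`. As `i : Fin (n + 1)`
starts at `0`, the sign is `(-1)^(i+1)`. -/
def pluckerRel {k : ℕ} (h : k + 1 = n) (α : Fin k ↪o Fin m) (β : Fin (n + 1) ↪o Fin m) :
    MvPolynomial (powersetCard (Fin m) n) F :=
  ∑ i : Fin (n + 1), (-1) ^ ((i : ℕ) + 1) *
    pluckerVar F ((Fin.snoc α (β i) : Fin (k + 1) → Fin m) ∘ Fin.cast h.symm) *
    pluckerVar F (fun j : Fin n => β (i.succAbove j))

/-- The tuple `(i, α₁, …, α_{n-2}, 2n-i+1)`, for `1 ≤ i ≤ n` and a tuple `α` of length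
`k = n - 2` in `{1, …, 2n}`. With indices starting at `0`, `2n-i+1` is `Fin.rev i`. -/
def pairTuple {k : ℕ} (h : k + 2 = n) (α : Fin k → Fin (2 * n)) (i : Fin n) :
    Fin n → Fin (2 * n) :=
  (Fin.cons (Fin.castLE (by omega) i)
    (Fin.snoc α (Fin.rev (Fin.castLE (by omega) i)) : Fin (k + 1) → Fin (2 * n)) :
      Fin (k + 2) → Fin (2 * n)) ∘ Fin.cast h.symm

/-- The linear form `Π_α = ∑_{i=1}^n c_{i,α,2n-i+1} X_{i,α,2n-i+1}` for an increasing tuple `α` of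
length `k = n - 2`, where `c` is `1` if the tuple has `n` distinct entries, and `0` otherwise. -/
def contractionForm {k : ℕ} (h : k + 2 = n) (α : Fin k ↪o Fin (2 * n)) :
    MvPolynomial (powersetCard (Fin (2 * n)) n) F :=
  ∑ i : Fin n,
    (if (Finset.univ.image (pairTuple h α i)).card = n then 1 else 0) *
      pluckerVar F (pairTuple h α i)

/-- The set of all Plücker relations `Q_{α,β}` with `α ∈ I(n-1,m)`, `β ∈ I(n+1,m)`. -/
def pluckerRels (n m : ℕ) : Set (MvPolynomial (powersetCard (Fin m) n) F) :=
  {f | ∃ (k : ℕ) (h : k + 1 = n) (α : Fin k ↪o Fin m) (β : Fin (n + 1) ↪o Fin m),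
    f = pluckerRel F h α β}

/-- The set of all linear forms `Π_α` with `α ∈ I(n-2,2n)`. -/
def contractionForms (n : ℕ) : Set (MvPolynomial (powersetCard (Fin (2 * n)) n) F) :=
  {f | ∃ (k : ℕ) (h : k + 2 = n) (α : Fin k ↪o Fin (2 * n)), f = contractionForm F h α}

end Plucker

section Symplectic

variable {F E : Type*} [Field F] [AddCommGroup E] [Module F E]

/-- A symplectic form: an alternating nondegenerate bilinear form. -/
def IsSymplecticForm (B : LinearMap.BilinForm F E) : Prop :=
  B.IsAlt ∧ B.Nondegenerate

/-- A symplectic basis `e₁, …, e₂ₙ`: for `i < j`, `⟨e_i, e_j⟩` is `1` if `j = 2n-i+1` and `0`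
otherwise. -/
def IsSymplecticBasis {n : ℕ} (B : LinearMap.BilinForm F E) (e : Basis (Fin (2 * n)) F E) : Prop :=
  ∀ i j : Fin (2 * n), i < j → B (e i) (e j) = if j = Fin.rev i then 1 else 0

/-- The set of Lagrangian subspaces (isotropic subspaces of dimension `n`) of `E`. -/
def lagrangianSubspaces (B : LinearMap.BilinForm F E) (n : ℕ) : Set (Submodule F E) :=
  {W | finrank F W = n ∧ ∀ u ∈ W, ∀ v ∈ W, B u v = 0}

/-- The Lagrangian-Grassmannian `L(n,E)` in its Plücker embedding: the set of the points
`[w₁ ∧ ⋯ ∧ wₙ]` of `ℙ(⋀ⁿ E)`, where `w₁, …, wₙ` is a basis of a Lagrangian subspace of `E`. -/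
def lagrangianGrassmannian (B : LinearMap.BilinForm F E) (n : ℕ) : Set (ℙ F (⋀[F]^n E)) :=
  {p | ∃ W ∈ lagrangianSubspaces B n, ∃ w : Basis (Fin n) F W,
    p.submodule = Submodule.span F {exteriorPower.ιMulti F n (fun i => (w i : E))}}

end Symplectic

end LagrangianGrassmannian

end

/-! View `ω ∈ ⋀ⁿ E` as an alternating form `P` on the dual of `E` (`pluckerForm`). The variable
`X_c` then evaluates to `P` on dual basis vectors, so the `Q_{α,β}` and `Π_γ` become multilinear
identities for `P`, which extend from basis tuples to all arguments.

If `P(g) ≠ 0`, Cramer's formula with respect to `g` defines a linear map `φ` to `Fⁿ`. The quadratic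
relations force `P` to vanish once an argument lies in `ker φ`, so `P` is a multiple of the
pulled-back determinant and `ω` is decomposable (`exists_eq_smul_detForm`). For independent `w₁, …,
wₙ`, the `Π_γ` contract `w₁ ∧ ⋯ ∧ wₙ` along the symplectic pairing. They vanish exactly when a
certain matrix is symmetric, which is isotropy of the `wᵢ` (`contractionForms_eval_eq_zero_iff`).
Hence the relations cut out `L(n,E)`, and the Nullstellensatz on the affine cone gives the ideal.

For irreducibility, two Lagrangian subspaces have spanning families `u`, `v` with `B(uᵢ, vⱼ)`
symmetric in `i, j`, so every family `(1 - t)u + tv` is isotropic. Polynomials nonzero at the two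
ends restrict to nonzero polynomials in `t`, and since `F` is infinite some `t` avoids all their
zeros (`exists_eval_ne_zero_of_lagrangian`). -/

noncomputable section

namespace LagrangianGrassmannian

open Module Set
open scoped LinearAlgebra.Projectivization

/-! ### Quadratic relations and decomposable alternating forms -/

section AlternatingForms

variable {F V N : Type*} [Field F] [AddCommGroup V] [Module F V] [AddCommGroup N] [Module F N]

/-- An alternating map vanishing on the increasing tuples of basis vectors is zero. -/
theorem alternatingMap_eq_zero_of_orderEmb {n m : ℕ} (b : Basis (Fin m) F V)
    (f : V [⋀^Fin n]→ₗ[F] N) (h : ∀ s : Fin n ↪o Fin m, f (fun i => b (s i)) = 0) : f = 0 := by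
  refine Basis.ext_alternating b fun v hv => ?_
  have hs : StrictMono (v ∘ Tuple.sort v) :=
    (Tuple.monotone_sort v).strictMono_of_injective (hv.comp (Tuple.sort v).injective)
  have h1 := h (OrderEmbedding.ofStrictMono _ hs)
  have h2 := f.map_perm (fun i => b (v i)) (Tuple.sort v)
  have h3 : f (((fun i => b (v i))) ∘ Tuple.sort v) = 0 := h1
  rw [h3] at h2
  exact ((smul_eq_zero_iff_eq _).1 h2.symm)

theorem neg_one_pow_zsmul_eq_zero {i : ℕ} {x : N} : (-1 : ℤ) ^ i • x = 0 ↔ x = 0 := by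
  rcases neg_one_pow_eq_or ℤ i with h | h <;> simp [h]

theorem alternatingMap_map_snoc {k : ℕ} (f : V [⋀^Fin (k + 1)]→ₗ[F] N) (a : Fin k → V) (x : V) :
    f (Fin.snoc a x) = (-1) ^ k • f (Fin.cons x a) := by
  have := f.map_insertNth (Fin.last k) x a
  rw [Fin.insertNth_last'] at this
  simpa [Matrix.vecCons] using this

/-- The quadratic Plücker expression of an alternating form. -/
def quadraticRel {k : ℕ} (P : V [⋀^Fin (k + 1)]→ₗ[F] F) (a : Fin k → V) (b : Fin (k + 2) → V) : F :=
  ∑ i : Fin (k + 2), (-1) ^ (i : ℕ) * P (Fin.snoc a (b i)) * P (i.removeNth b)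

/-- Up to sign the expression is alternating in `a` for fixed `b`, and it is alternating in `b` for
fixed `a`, so each slot can be extended from increasing basis tuples in turn. -/
theorem quadraticRel_eq_zero_of_basis {k m : ℕ} (e : Basis (Fin m) F V)
    (P : V [⋀^Fin (k + 1)]→ₗ[F] F)
    (h : ∀ (s : Fin k ↪o Fin m) (t : Fin (k + 2) ↪o Fin m),
      quadraticRel P (fun i => e (s i)) (fun i => e (t i)) = 0)
    (a : Fin k → V) (b : Fin (k + 2) → V) : quadraticRel P a b = 0 := by
  let A (b : Fin (k + 2) → V) : V [⋀^Fin k]→ₗ[F] F :=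
    ∑ i : Fin (k + 2), ((-1) ^ (i : ℕ) * P (i.removeNth b)) • P.curryLeft (b i)
  have hA (a b) : quadraticRel P a b = (-1) ^ k * A b a := by
    let ev : (V [⋀^Fin k]→ₗ[F] F) →+ F :=
      { toFun := fun f => f a, map_zero' := rfl, map_add' := fun _ _ => rfl }
    have h1 : A b a = ∑ i : Fin (k + 2),
        ev (((-1) ^ (i : ℕ) * P (i.removeNth b)) • P.curryLeft (b i)) :=
      map_sum ev _ _
    rw [h1, quadraticRel, Finset.mul_sum]
    refine Finset.sum_congr rfl fun i _ => ?_
    have h2 : ev (((-1) ^ (i : ℕ) * P (i.removeNth b)) • P.curryLeft (b i)) =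
      (-1) ^ (i : ℕ) * P (i.removeNth b) * P (Fin.cons (b i) a) := rfl
    rw [h2, alternatingMap_map_snoc, zsmul_eq_mul]
    push_cast
    ring
  let Bm (a : Fin k → V) : V [⋀^Fin (k + 2)]→ₗ[F] F :=
    AlternatingMap.alternatizeUncurryFin
      ((P.toMultilinearMap.toLinearMap (Fin.snoc a 0) (Fin.last k)).smulRight P)
  have hB (a b) : quadraticRel P a b = Bm a b := by
    simp only [quadraticRel, Bm, AlternatingMap.alternatizeUncurryFin_apply,
      LinearMap.smulRight_apply, MultilinearMap.toLinearMap_apply, Fin.update_snoc_last,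
      AlternatingMap.smul_apply, smul_eq_mul, zsmul_eq_mul]
    refine Finset.sum_congr rfl fun i _ => ?_
    push_cast
    rw [mul_assoc]
  have h1 (s : Fin k ↪o Fin m) : Bm (fun i => e (s i)) = 0 :=
    alternatingMap_eq_zero_of_orderEmb e _ fun t => by rw [← hB, h]
  have h2 (b) : A b = 0 := alternatingMap_eq_zero_of_orderEmb e _ fun s => by
    have := hB (fun i => e (s i)) b
    rw [h1, hA] at this
    simpa using this
  rw [hA, h2]
  simp

/-- The alternating form `c ↦ det (c_j(w_i))`, written with the linear map `c ↦ (c(w_i))_i`. -/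
def detForm {n : ℕ} (φ : V →ₗ[F] (Fin n → F)) : V [⋀^Fin n]→ₗ[F] F :=
  (Pi.basisFun F (Fin n)).det.compLinearMap φ

theorem detForm_apply {n : ℕ} (φ : V →ₗ[F] (Fin n → F)) (c : Fin n → V) :
    detForm φ c = Matrix.det (Matrix.of fun i j => φ (c j) i) := by
  simp only [detForm, AlternatingMap.compLinearMap_apply, Basis.det_apply]
  congr 1

/-- A nonzero alternating form satisfying the Plücker relations is a multiple of a determinant. -/
theorem exists_eq_smul_detForm {k : ℕ} (P : V [⋀^Fin (k + 1)]→ₗ[F] F)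
    (h : ∀ a b, quadraticRel P a b = 0) (hP : P ≠ 0) :
    ∃ (φ : V →ₗ[F] (Fin (k + 1) → F)) (r : F), P = r • detForm φ := by
  obtain ⟨g, hg⟩ : ∃ g, P g ≠ 0 := by
    by_contra! H
    exact hP (AlternatingMap.ext H)
  -- Cramer's rule: the coordinates of `x` relative to `g`.
  let φ : V →ₗ[F] (Fin (k + 1) → F) :=
    LinearMap.pi fun i => (P g)⁻¹ • P.toMultilinearMap.toLinearMap g i
  have hφ (x i) : φ x i = (P g)⁻¹ * P (Function.update g i x) := rfl
  have hφg (j) : φ (g j) = Pi.single j 1 := by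
    ext i
    rw [hφ]
    rcases eq_or_ne i j with rfl | hij
    · rw [Function.update_eq_self, inv_mul_cancel₀ hg, Pi.single_eq_same]
    · rw [P.map_update_self g hij, mul_zero, Pi.single_eq_of_ne hij]
  have hker (x : V) (hx : φ x = 0) (a : Fin k → V) : P (Fin.snoc a x) = 0 := by
    -- The term `i = 0` is `P(a, x) P(g)`; every other term contains, up to sign, `P` of `g` with
    -- one entry replaced by `x`, which is zero since `φ x = 0`.
    have h1 := h a (Fin.cons x g)
    rw [quadraticRel, Fin.sum_univ_succ, Finset.sum_eq_zero] at h1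
    · simpa [hg] using h1
    · intro i _
      have h2 : P (Function.update g i x) = 0 := by
        have := congrFun hx i
        rw [hφ] at this
        simpa [hg] using this
      have h3 : i.succ.removeNth (Fin.cons x g : Fin (k + 2) → V)
          = Fin.cons x (i.removeNth g) := by
        ext j
        refine Fin.cases ?_ (fun j => ?_) j <;> simp [Fin.removeNth]
      have h4 := P.map_insertNth i x (i.removeNth g)
      rw [Fin.insertNth_removeNth, h2] at h4
      have h5 : P (Fin.cons x (i.removeNth g)) = 0 := by
        exact neg_one_pow_zsmul_eq_zero.1 h4.symm
      rw [h3, h5, mul_zero]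
  have hker' (c : Fin (k + 1) → V) (i) (hx : φ (c i) = 0) : P c = 0 := by
    have h4 := P.map_insertNth i (c i) (i.removeNth c)
    have h5 := alternatingMap_map_snoc P (i.removeNth c) (c i)
    rw [hker _ hx] at h5
    rw [Fin.insertNth_self_removeNth] at h4
    have h6 : P (Fin.cons (c i) (i.removeNth c)) = 0 := by
      exact neg_one_pow_zsmul_eq_zero.1 h5.symm
    rw [h4, Matrix.vecCons, h6, smul_zero]
  let T : (Fin (k + 1) → F) →ₗ[F] V := Fintype.linearCombination F g
  have hT (x) : φ (T x) = x := by
    ext i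
    simp [T, Fintype.linearCombination_apply, hφg, Pi.single_apply]
  refine ⟨φ, P g, AlternatingMap.ext fun c => ?_⟩
  -- Split each `c i` into `T (φ (c i))` and a vector of `ker φ`; in the multilinear expansion only
  -- the term free of kernel vectors survives.
  have h1 : P c = P (fun i => T (φ (c i))) := by
    have h2 := P.toMultilinearMap.map_add_univ (fun i => T (φ (c i))) (fun i => c i - T (φ (c i)))
    rw [Finset.sum_eq_single Finset.univ] at h2
    · have h3 : ((fun i => T (φ (c i))) + fun i => c i - T (φ (c i))) = c := by
        ext i; simp
      rw [h3, Finset.piecewise_univ] at h2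
      exact h2
    · intro s _ hs
      obtain ⟨i, hi⟩ : ∃ i, i ∉ s := by
        by_contra! H
        exact hs (Finset.eq_univ_iff_forall.2 H)
      refine hker' _ i ?_
      simp [hi, hT]
    · simp
  have h2 := (P.compLinearMap T).eq_smul_basis_det (Pi.basisFun F (Fin (k + 1)))
  have h3 := DFunLike.congr_fun h2 (fun i => φ (c i))
  simp only [AlternatingMap.compLinearMap_apply, AlternatingMap.smul_apply] at h3
  rw [h1, h3]
  simp [detForm, T, Fintype.linearCombination_apply_single]

/-- Laplace expansion along the top row of a determinant whose top row `l(bⱼ)` is a combination of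
the other rows. -/
theorem quadraticRel_detForm {k : ℕ} (φ : V →ₗ[F] (Fin (k + 1) → F)) (a : Fin k → V)
    (b : Fin (k + 2) → V) : quadraticRel (detForm φ) a b = 0 := by
  let l : V →ₗ[F] F := (detForm φ).toMultilinearMap.toLinearMap (Fin.snoc a 0) (Fin.last k)
  have hl (x) : l x = detForm φ (Fin.snoc a x) := by
    simp only [l, MultilinearMap.toLinearMap_apply, Fin.update_snoc_last]
    rfl
  obtain ⟨c, hc⟩ : ∃ c : Fin (k + 1) → F, ∀ x, l x = ∑ i, c i * φ x i := by
    let d := (Pi.basisFun F (Fin (k + 1))).det.toMultilinearMap.toLinearMap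
      (Fin.snoc (fun i => φ (a i)) 0) (Fin.last k)
    refine ⟨fun i => d (Pi.single i 1), fun x => ?_⟩
    have h1 : l x = d (φ x) := by
      rw [hl]
      simp only [detForm, AlternatingMap.compLinearMap_apply, d, MultilinearMap.toLinearMap_apply,
        Fin.update_snoc_last, AlternatingMap.coe_multilinearMap]
      congr 1
      ext i : 1
      refine Fin.lastCases ?_ (fun i => ?_) i <;> simp
    rw [h1]
    conv_lhs => rw [pi_eq_sum_univ' (φ x)]
    simp [map_sum, mul_comm]
  let M : Matrix (Fin (k + 2)) (Fin (k + 2)) F :=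
    Matrix.of fun i j => (Fin.cons (l (b j)) (φ (b j)) : Fin (k + 2) → F) i
  have hM : M.det = 0 := by
    refine Matrix.exists_vecMul_eq_zero_iff.1 ⟨Fin.cons 1 (fun i => - c i), ?_, ?_⟩
    · intro H
      simpa using congrFun H 0
    · ext j
      simp [Matrix.vecMul, dotProduct, Fin.sum_univ_succ, M, hc]
  rw [Matrix.det_succ_row_zero] at hM
  rw [← hM, quadraticRel]
  refine Finset.sum_congr rfl fun i _ => ?_
  rw [← hl, detForm_apply (c := i.removeNth b)]
  rfl

end AlternatingForms

/-! ### Contractions of determinant forms -/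

section Contraction

variable {F V : Type*} [Field F] [AddCommGroup V] [Module F V]

/-- The contraction `∑ᵢ P(xᵢ, a, yᵢ)` of an alternating form. -/
def contraction {k N : ℕ} (P : V [⋀^Fin (k + 2)]→ₗ[F] F) (x y : Fin N → V) (a : Fin k → V) : F :=
  ∑ i, P (Fin.cons (x i) (Fin.snoc a (y i) : Fin (k + 1) → V))

/-- The bilinear form `(u, v) ↦ P(u, v, a)`. -/
def firstTwo {k : ℕ} (P : V [⋀^Fin (k + 2)]→ₗ[F] F) (a : Fin k → V) : LinearMap.BilinForm F V :=
  LinearMap.mk₂ F (fun u v => (P.curryLeft u).curryLeft v a)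
    (fun _ _ _ => by simp only [map_add, AlternatingMap.curryLeft_add, LinearMap.add_apply,
      AlternatingMap.add_apply])
    (fun _ _ _ => by simp only [map_smul, AlternatingMap.curryLeft_smul, LinearMap.smul_apply,
      AlternatingMap.smul_apply])
    (fun _ _ _ => by simp only [map_add, AlternatingMap.add_apply])
    (fun _ _ _ => by simp only [map_smul, AlternatingMap.smul_apply])

theorem firstTwo_apply {k : ℕ} (P : V [⋀^Fin (k + 2)]→ₗ[F] F) (a : Fin k → V) (u v : V) :
    firstTwo P a u v = P (Fin.cons u (Fin.cons v a : Fin (k + 1) → V)) := rfl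

theorem firstTwo_isAlt {k : ℕ} (P : V [⋀^Fin (k + 2)]→ₗ[F] F) (a : Fin k → V) :
    (firstTwo P a).IsAlt := fun u =>
  P.map_eq_zero_of_eq (i := 0) (j := 1) _ rfl (by simp)

theorem contraction_eq {k N : ℕ} (P : V [⋀^Fin (k + 2)]→ₗ[F] F) (x y : Fin N → V) (a : Fin k → V) :
    contraction P x y a = (-1) ^ k * ∑ i, firstTwo P a (x i) (y i) := by
  rw [contraction, Finset.mul_sum]
  refine Finset.sum_congr rfl fun i _ => ?_
  have := alternatingMap_map_snoc (P.curryLeft (x i)) a (y i)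
  rw [zsmul_eq_mul] at this
  push_cast at this
  exact this

theorem contraction_eq_zero_of_basis {k N m : ℕ} (e : Basis (Fin m) F V)
    (P : V [⋀^Fin (k + 2)]→ₗ[F] F) (x y : Fin N → V)
    (h : ∀ s : Fin k ↪o Fin m, contraction P x y (fun i => e (s i)) = 0) (a : Fin k → V) :
    contraction P x y a = 0 := by
  let A : V [⋀^Fin k]→ₗ[F] F := ∑ i, (P.curryLeft (x i)).curryLeft (y i)
  have hA (a) : contraction P x y a = (-1) ^ k * A a := by
    let ev : (V [⋀^Fin k]→ₗ[F] F) →+ F :=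
      { toFun := fun f => f a, map_zero' := rfl, map_add' := fun _ _ => rfl }
    have h1 : A a = ∑ i, ev ((P.curryLeft (x i)).curryLeft (y i)) := map_sum ev _ _
    rw [contraction_eq, h1]
    rfl
  have h2 : A = 0 := alternatingMap_eq_zero_of_orderEmb e _ fun s => by
    have := h s
    rw [hA] at this
    simpa using this
  rw [hA, h2]
  simp

/-- The terms at `(s, t)` and `(t, s)` cancel. Diagonal terms vanish by `hD`, so characteristic 2 is
covered. -/
theorem sum_mul_eq_zero_of_symm_of_alt {ι : Type*} [Fintype ι] {C D : ι → ι → F}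
    (hC : ∀ s t, C s t = C t s) (hD : ∀ s, D s s = 0) (hD' : ∀ s t, D s t = - D t s) :
    ∑ s, ∑ t, C s t * D s t = 0 := by
  classical
  rw [← Finset.sum_product']
  refine Finset.sum_involution (fun p _ => p.swap) ?_ ?_ (by simp) (by simp)
  · rintro ⟨s, t⟩ _
    simp only [Prod.fst_swap, Prod.snd_swap]
    rw [hC t s, hD' t s]
    ring
  · rintro ⟨s, t⟩ _ h1 h2
    obtain rfl : t = s := congrArg Prod.fst h2
    simp [hD] at h1

theorem bilin_pi_apply {n : ℕ} (D : LinearMap.BilinForm F (Fin n → F)) (u v : Fin n → F) :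
    D u v = ∑ s, ∑ t, u s * v t * D (Pi.single s 1) (Pi.single t 1) := by
  conv_lhs => rw [pi_eq_sum_univ' u, pi_eq_sum_univ' v]
  simp only [map_sum, LinearMap.sum_apply, map_smul, LinearMap.smul_apply, smul_eq_mul]
  rw [Finset.sum_comm]
  refine Finset.sum_congr rfl fun s _ => ?_
  rw [Finset.mul_sum]
  refine Finset.sum_congr rfl fun t _ => ?_
  ring

theorem contraction_detForm {k N : ℕ} (φ : V →ₗ[F] (Fin (k + 2) → F)) (x y : Fin N → V)
    (a : Fin k → V) :
    contraction (detForm φ) x y a = (-1) ^ k * ∑ s, ∑ t, (∑ i, φ (x i) s * φ (y i) t) *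
      firstTwo (Pi.basisFun F (Fin (k + 2))).det (fun i => φ (a i))
        (Pi.single s 1) (Pi.single t 1) := by
  have h1 (u v : V) : firstTwo (detForm φ) a u v =
      firstTwo (Pi.basisFun F (Fin (k + 2))).det (fun i => φ (a i)) (φ u) (φ v) := by
    rw [firstTwo_apply, firstTwo_apply, detForm, AlternatingMap.compLinearMap_apply]
    congr 1
    ext i : 1
    refine Fin.cases ?_ (fun i => Fin.cases ?_ (fun i => ?_) i) i <;> simp
  rw [contraction_eq]
  congr 1
  simp only [h1]
  simp_rw [bilin_pi_apply _ (φ (x _)), Finset.sum_mul]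
  rw [Finset.sum_comm]
  refine Finset.sum_congr rfl fun s _ => ?_
  rw [Finset.sum_comm]

/-- The contractions of a decomposable form vanish exactly if the contracted tensor is symmetric on
the vectors defining the form. -/
theorem contraction_detForm_eq_zero_iff {k N : ℕ} {φ : V →ₗ[F] (Fin (k + 2) → F)}
    (hφ : Function.Surjective φ) (x y : Fin N → V) :
    (∀ a, contraction (detForm φ) x y a = 0) ↔
      ∀ s t, ∑ i, φ (x i) s * φ (y i) t = ∑ i, φ (x i) t * φ (y i) s := by
  constructor
  · intro h s t
    rcases eq_or_ne s t with rfl | hst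
    · rfl
    -- A permutation with `ρ 0 = s` and `ρ 1 = t`. Filling `a` with preimages of the remaining unit
    -- vectors leaves only the terms `(s, t)` and `(t, s)` of the double sum.
    let ρ : Equiv.Perm (Fin (k + 2)) := Equiv.swap 0 s * Equiv.swap 1 (Equiv.swap 0 s t)
    have h01 : (0 : Fin (k + 2)) ≠ 1 := by simp
    have hρ1 : ρ 1 = t := by simp [ρ]
    have hρ0 : ρ 0 = s := by
      have : (0 : Fin (k + 2)) ≠ Equiv.swap 0 s t := by
        intro H
        have := congrArg (Equiv.swap 0 s) H
        rw [Equiv.swap_apply_left, Equiv.swap_apply_self] at this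
        exact hst this
      simp [ρ, Equiv.swap_apply_of_ne_of_ne h01 this]
    choose g hg using hφ
    let δ : Fin (k + 2) → Fin (k + 2) → F := fun i => Pi.single i 1
    have h1 := h (fun j => g (δ (ρ j.succ.succ)))
    rw [contraction_detForm, mul_eq_zero, or_iff_right (by simp)] at h1
    simp only [hg] at h1
    set D := firstTwo (Pi.basisFun F (Fin (k + 2))).det (fun j : Fin k => δ (ρ j.succ.succ))
      with hD
    have hD0 (p q) (h2 : ∃ j : Fin k, ρ j.succ.succ = p) : D (δ p) (δ q) = 0 := by
      obtain ⟨j, rfl⟩ := h2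
      rw [hD, firstTwo_apply]
      refine AlternatingMap.map_eq_zero_of_eq _ _ (i := 0) (j := j.succ.succ) ?_ (by simp [Fin.ext_iff])
      simp
    have hDst : D (δ s) (δ t) ≠ 0 := by
      rw [hD, firstTwo_apply]
      have h2 : (Fin.cons (δ s) (Fin.cons (δ t) (fun j : Fin k => δ (ρ j.succ.succ)) :
          Fin (k + 1) → _) : Fin (k + 2) → _) = δ ∘ ρ := by
        ext i : 1
        refine Fin.cases ?_ (fun i => Fin.cases ?_ (fun i => ?_) i) i
        · simp [hρ0]
        · simp [hρ1]
        · simp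
      rw [h2, AlternatingMap.map_perm]
      have h3 : δ = Pi.basisFun F (Fin (k + 2)) := by
        ext i : 1
        simp [δ]
      rw [h3, Basis.det_self]
      rcases Int.units_eq_one_or (Equiv.Perm.sign ρ) with h4 | h4 <;> simp [h4]
    have hcases (p : Fin (k + 2)) : p = s ∨ p = t ∨ ∃ j : Fin k, ρ j.succ.succ = p := by
      obtain ⟨i, rfl⟩ := ρ.surjective p
      refine Fin.cases ?_ (fun i => Fin.cases ?_ (fun i => ?_) i) i
      · simp [hρ0]
      · simp [hρ1]
      · exact Or.inr (Or.inr ⟨i, rfl⟩)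
    have hneg (p q) : D (δ p) (δ q) = - D (δ q) (δ p) :=
      ((firstTwo_isAlt _ _).neg_eq _ _).symm
    have hself (p) : D (δ p) (δ p) = 0 := firstTwo_isAlt _ _ _
    have hrow (p) (hs : p ≠ s) (ht : p ≠ t) : ∃ j : Fin k, ρ j.succ.succ = p := by
      rcases hcases p with h | h | h
      exacts [absurd h hs, absurd h ht, h]
    have h3 (q) (C : Fin (k + 2) → F) : ∑ p, C p * D (δ q) (δ p) =
        C s * D (δ q) (δ s) + C t * D (δ q) (δ t) := by
      refine Fintype.sum_eq_add _ _ hst fun p hp => ?_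
      rw [hneg, hD0 _ _ (hrow p hp.1 hp.2)]
      simp
    have h4 : ∀ p, (Pi.single p 1 : Fin (k + 2) → F) = δ p := fun _ => rfl
    simp only [h4, h3] at h1
    rw [Fintype.sum_eq_add s t hst, hself, hself, hneg t s] at h1
    · rw [← sub_eq_zero]
      refine (mul_eq_zero.1 ?_).resolve_right hDst
      rw [← h1]
      ring
    · intro p hp
      rw [hD0 _ _ (hrow p hp.1 hp.2), hD0 _ _ (hrow p hp.1 hp.2)]
      simp
  · intro h a
    rw [contraction_detForm, sum_mul_eq_zero_of_symm_of_alt h, mul_zero]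
    · exact fun s => firstTwo_isAlt _ _ _
    · exact fun s t => ((firstTwo_isAlt _ _).neg_eq _ _).symm

end Contraction

/-! ### Plücker coordinates as values of alternating forms -/

section PluckerForm

variable {F E : Type*} [Field F] [AddCommGroup E] [Module F E]

/-- The alternating form on the dual of `E` attached to an element of `⋀ⁿ E`. -/
def pluckerForm {n : ℕ} (ω : ⋀[F]^n E) : (Dual F E) [⋀^Fin n]→ₗ[F] F :=
  (Module.Dual.eval F (⋀[F]^n E) ω).compAlternatingMap (exteriorPower.alternatingMapToDual F E n)

theorem pluckerForm_smul {n : ℕ} (r : F) (ω : ⋀[F]^n E) :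
    pluckerForm (r • ω) = r • pluckerForm ω := by
  ext c
  simp [pluckerForm]

/-- Evaluation of linear forms at the vectors `wᵢ`. -/
def evalAt {n : ℕ} (w : Fin n → E) : Dual F E →ₗ[F] (Fin n → F) :=
  LinearMap.pi fun i => Module.Dual.eval F E (w i)

@[simp]
theorem evalAt_apply {n : ℕ} (w : Fin n → E) (c : Dual F E) (i : Fin n) :
    evalAt w c i = c (w i) := rfl

theorem pluckerForm_ιMulti {n : ℕ} (w : Fin n → E) :
    pluckerForm (exteriorPower.ιMulti F n w) = detForm (evalAt w) := by
  ext c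
  rw [detForm_apply]
  simp [pluckerForm]

theorem evalAt_surjective_of_linearIndependent {n : ℕ} {w : Fin n → E}
    (hw : LinearIndependent F w) : Function.Surjective (evalAt (F := F) w) := by
  intro c
  obtain ⟨f, hf⟩ := LinearMap.exists_extend
    ((Finsupp.linearCombination F c) ∘ₗ hw.repr : Submodule.span F (range w) →ₗ[F] F)
  refine ⟨f, ?_⟩
  ext i
  have h1 := LinearMap.congr_fun hf ⟨w i, Submodule.subset_span (mem_range_self i)⟩
  simp only [LinearMap.comp_apply, Submodule.subtype_apply] at h1
  rw [evalAt_apply, h1, hw.repr_eq_single i _ rfl]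
  simp

variable {m : ℕ} (e : Basis (Fin m) F E)

theorem exists_eq_evalAt {m : ℕ} (e : Basis (Fin m) F E) {n : ℕ}
    (φ : Dual F E →ₗ[F] (Fin n → F)) : ∃ w, φ = evalAt w := by
  refine ⟨fun i => ∑ j, φ (e.coord j) i • e j, e.dualBasis.ext fun j => ?_⟩
  ext i
  simp [Finsupp.single_apply]

theorem eval_pluckerVar {n : ℕ} (ω : ⋀[F]^n E) (c : Fin n → Fin m) :
    MvPolynomial.eval (fun s => (e.exteriorPower n).repr ω s) (pluckerVar F c) =
      pluckerForm ω (fun i => e.coord (c i)) := by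
  by_cases hc : Function.Injective c
  · have hs : StrictMono (c ∘ Tuple.sort c) :=
      (Tuple.monotone_sort c).strictMono_of_injective (hc.comp (Tuple.sort c).injective)
    have h1 : powersetCard.ofFinEmb n (Fin m) ⟨c, hc⟩ =
        powersetCard.ofFinEmbEquiv (OrderEmbedding.ofStrictMono _ hs) := by
      refine SetLike.ext fun i => ?_
      rw [powersetCard.ofFinEmbEquiv_apply, powersetCard.mem_ofFinEmb_iff_mem_range,
        powersetCard.mem_ofFinEmb_iff_mem_range]
      exact ((Tuple.sort c).surjective.exists (p := fun j => c j = i))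
    have h2 : (e.exteriorPower n).repr ω (powersetCard.ofFinEmb n (Fin m) ⟨c, hc⟩) =
        pluckerForm ω ((fun i => e.coord (c i)) ∘ Tuple.sort c) := by
      rw [exteriorPower.basis_repr_apply, exteriorPower.ιMultiDual, exteriorPower.ιMulti_family, h1,
        Equiv.symm_apply_apply, exteriorPower.pairingDual,
        exteriorPower.alternatingMapLinearEquiv_apply_ιMulti]
      rfl
    rw [pluckerVar, dif_pos hc, map_mul, MvPolynomial.eval_C, MvPolynomial.eval_X, h2,
      AlternatingMap.map_perm, Units.smul_def, zsmul_eq_mul, ← mul_assoc, ← Int.cast_mul,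
      ← Units.val_mul, Int.units_mul_self]
    simp
  · rw [pluckerVar, dif_neg hc, map_zero]
    obtain ⟨i, j, hij, hne⟩ : ∃ i j, c i = c j ∧ i ≠ j := by
      simpa [Function.Injective] using hc
    exact ((pluckerForm ω).map_eq_zero_of_eq _ (by rw [hij]) hne).symm

theorem eval_pluckerRel {k : ℕ} (ω : ⋀[F]^(k + 1) E) (α : Fin k ↪o Fin m)
    (β : Fin (k + 2) ↪o Fin m) :
    MvPolynomial.eval (fun s => (e.exteriorPower (k + 1)).repr ω s) (pluckerRel F rfl α β) =
      - quadraticRel (pluckerForm ω) (fun i => e.coord (α i)) (fun i => e.coord (β i)) := by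
  rw [pluckerRel, map_sum, quadraticRel, ← Finset.sum_neg_distrib]
  refine Finset.sum_congr rfl fun i _ => ?_
  simp only [map_mul, eval_pluckerVar, map_pow, map_neg, map_one]
  have h1 : (fun j : Fin (k + 1) => e.coord ((Fin.snoc α (β i) : Fin (k + 1) → Fin m) j)) =
      Fin.snoc (fun i => e.coord (α i)) (e.coord (β i)) := by
    ext j : 1
    refine Fin.lastCases ?_ (fun j => ?_) j <;> simp
  have h2 : i.removeNth (fun i => e.coord (β i)) = fun j => e.coord (β (i.succAbove j)) := rfl
  rw [← h1, h2, pow_succ]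
  simp only [Function.comp_apply, Fin.cast_eq_self]
  ring

theorem eval_contractionForm {k : ℕ} (e : Basis (Fin (2 * (k + 2))) F E) (ω : ⋀[F]^(k + 2) E)
    (α : Fin k ↪o Fin (2 * (k + 2))) :
    MvPolynomial.eval (fun s => (e.exteriorPower (k + 2)).repr ω s) (contractionForm F rfl α) =
      contraction (pluckerForm ω) (fun i : Fin (k + 2) => e.coord (Fin.castLE (by omega) i))
        (fun i => e.coord (Fin.rev (Fin.castLE (by omega) i))) (fun i => e.coord (α i)) := by
  rw [contractionForm, map_sum, contraction]
  refine Finset.sum_congr rfl fun i _ => ?_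
  -- The coefficient `c_{i,γ}` is redundant: `X_c` is already zero on tuples with a repetition.
  have h1 (c : Fin (k + 2) → Fin (2 * (k + 2))) :
      (if (Finset.univ.image c).card = k + 2 then 1 else 0) * pluckerVar F c = pluckerVar F c := by
    split_ifs with h
    · rw [one_mul]
    · rw [pluckerVar, dif_neg, mul_zero]
      intro hc
      exact h (by rw [Finset.card_image_of_injective _ hc, Finset.card_fin])
  rw [h1, eval_pluckerVar]
  congr 1
  ext j : 1
  refine Fin.cases ?_ (fun j => Fin.lastCases ?_ (fun j => ?_) j) j <;> simp [pairTuple]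

theorem eq_of_pluckerForm_eq {m : ℕ} (e : Basis (Fin m) F E) {n : ℕ} {ω ω' : ⋀[F]^n E}
    (h : pluckerForm ω = pluckerForm ω') : ω = ω' := by
  refine (e.exteriorPower n).repr.injective (Finsupp.ext fun s => ?_)
  rw [exteriorPower.basis_repr_apply, exteriorPower.basis_repr_apply, exteriorPower.ιMultiDual,
    exteriorPower.ιMulti_family, exteriorPower.pairingDual,
    exteriorPower.alternatingMapLinearEquiv_apply_ιMulti]
  exact DFunLike.congr_fun h _

/-- The Plücker relations cut out the decomposable elements. -/
theorem pluckerRels_eval_eq_zero_iff {k : ℕ} {ω : ⋀[F]^(k + 1) E} (hω : ω ≠ 0) :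
    (∀ f ∈ pluckerRels F (k + 1) m,
      MvPolynomial.eval (fun s => (e.exteriorPower (k + 1)).repr ω s) f = 0) ↔
      ∃ w, ω = exteriorPower.ιMulti F (k + 1) w := by
  constructor
  · intro h
    obtain ⟨φ, r, hr⟩ := exists_eq_smul_detForm (pluckerForm ω)
      (quadraticRel_eq_zero_of_basis e.dualBasis _ fun α β => by
        have := h _ ⟨k, rfl, α, β, rfl⟩
        rw [eval_pluckerRel] at this
        simpa using this)
      (fun h0 => hω (eq_of_pluckerForm_eq e (by
        rw [h0]
        ext
        simp [pluckerForm])))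
    obtain ⟨w, rfl⟩ := exists_eq_evalAt e φ
    -- The scalar is absorbed into the first vector.
    refine ⟨Function.update w 0 (r • w 0), eq_of_pluckerForm_eq e ?_⟩
    rw [hr, AlternatingMap.map_update_smul, pluckerForm_smul, Function.update_eq_self,
      pluckerForm_ιMulti]
  · rintro ⟨w, rfl⟩ _ ⟨k', hk, α, β, rfl⟩
    obtain rfl : k' = k := by omega
    rw [eval_pluckerRel, pluckerForm_ιMulti, quadraticRel_detForm, neg_zero]

end PluckerForm

/-! ### The forms `Π_γ` and isotropy -/

section Symplectic

variable {F E : Type*} [Field F] [AddCommGroup E] [Module F E]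

theorem sum_fin_two_mul {n : ℕ} (f : Fin (2 * n) → F) :
    ∑ i, f i = ∑ i : Fin n, (f (Fin.castLE (by omega) i) + f (Fin.rev (Fin.castLE (by omega) i))) := by
  have key : ∀ N (h : N = n + n) (f : Fin N → F), ∑ i, f i =
      ∑ i : Fin n, (f (Fin.castLE (by omega) i) + f (Fin.rev (Fin.castLE (by omega) i))) := by
    rintro _ rfl f
    rw [Fin.sum_univ_add, Finset.sum_add_distrib]
    congr 1
    rw [← Equiv.sum_comp Fin.revPerm]
    refine Finset.sum_congr rfl fun i _ => congrArg f ?_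
    ext
    simp [Fin.val_rev]
    omega
  exact key _ (by omega) f

/-- This shape makes `B (w s) (w t) = 0` literally the symmetry condition of
`contraction_detForm_eq_zero_iff`. -/
theorem IsSymplecticBasis.apply_eq {n : ℕ} {B : LinearMap.BilinForm F E} (hB : B.IsAlt)
    {e : Basis (Fin (2 * n)) F E} (he : IsSymplecticBasis B e) (u v : E) :
    B u v = ∑ i : Fin n,
      (e.coord (Fin.castLE (by omega) i) u * e.coord (Fin.rev (Fin.castLE (by omega) i)) v -
        e.coord (Fin.castLE (by omega) i) v * e.coord (Fin.rev (Fin.castLE (by omega) i)) u) := by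
  have h1 (i j : Fin (2 * n)) :
      B (e i) (e j) = if j = Fin.rev i then (if i < Fin.rev i then 1 else -1) else 0 := by
    rcases lt_trichotomy i j with h | rfl | h
    · rw [he i j h]
      split_ifs with h1 h2
      · rfl
      · exact absurd (h1 ▸ h) h2
      · rfl
    · rw [hB, if_neg]
      intro h
      have := congrArg Fin.val h
      rw [Fin.val_rev] at this
      omega
    · rw [← hB.neg_eq, he j i h]
      have h2 : i = Fin.rev j ↔ j = Fin.rev i := by
        constructor <;> (intro h; rw [h, Fin.rev_rev])
      simp only [h2]
      split_ifs with h3 h4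
      · exact absurd (h3 ▸ h) (lt_asymm h4)
      · rfl
      · simp
  have h2 : B u v = ∑ i, ∑ j, e.coord i u * e.coord j v * B (e i) (e j) := by
    conv_lhs => rw [← e.sum_repr u, ← e.sum_repr v]
    simp only [map_sum, LinearMap.sum_apply, map_smul, LinearMap.smul_apply, smul_eq_mul,
      Basis.coord_apply]
    rw [Finset.sum_comm]
    refine Finset.sum_congr rfl fun s _ => ?_
    rw [Finset.mul_sum]
    refine Finset.sum_congr rfl fun t _ => ?_
    ring
  rw [h2]
  simp only [h1, mul_ite, mul_zero, Finset.sum_ite_eq', Finset.mem_univ, if_true]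
  rw [sum_fin_two_mul]
  refine Finset.sum_congr rfl fun i _ => ?_
  have h3 : Fin.castLE (by omega) i < Fin.rev (Fin.castLE (by omega : n ≤ 2 * n) i) := by
    rw [Fin.lt_def, Fin.val_rev]
    simp
    omega
  rw [Fin.rev_rev, if_pos h3, if_neg h3.le.not_gt]
  ring

/-- The linear forms `Π_γ` vanish at a decomposable element exactly if it comes from an isotropic
subspace. -/
theorem contractionForms_eval_eq_zero_iff {n : ℕ} (hn : 2 ≤ n) {B : LinearMap.BilinForm F E}
    (hB : B.IsAlt) {e : Basis (Fin (2 * n)) F E} (he : IsSymplecticBasis B e) {w : Fin n → E}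
    (hw : LinearIndependent F w) :
    (∀ f ∈ contractionForms F n, MvPolynomial.eval
      (fun s => (e.exteriorPower n).repr (exteriorPower.ιMulti F n w) s) f = 0) ↔
      ∀ s t, B (w s) (w t) = 0 := by
  obtain ⟨k, rfl⟩ : ∃ k, n = k + 2 := ⟨n - 2, by omega⟩
  have h1 := contraction_detForm_eq_zero_iff (evalAt_surjective_of_linearIndependent hw)
    (fun i : Fin (k + 2) => e.coord (Fin.castLE (by omega) i))
    (fun i => e.coord (Fin.rev (Fin.castLE (by omega) i)))
  simp only [he.apply_eq hB, Finset.sum_sub_distrib, sub_eq_zero]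
  refine Iff.trans ?_ (h1.trans (forall₂_congr fun s t => by
    simp only [evalAt_apply]))
  constructor
  · intro h
    refine contraction_eq_zero_of_basis e.dualBasis _ _ _ fun α => ?_
    have := h _ ⟨k, rfl, α, rfl⟩
    rw [eval_contractionForm, pluckerForm_ιMulti] at this
    simpa using this
  · rintro h _ ⟨k', hk, α, rfl⟩
    obtain rfl : k' = k := by omega
    rw [eval_contractionForm, pluckerForm_ιMulti, h]

end Symplectic

/-! ### Homogeneous polynomials and the projective Nullstellensatz -/

section Homogeneous

variable {F V σ : Type*} [Field F] [AddCommGroup V] [Module F V]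

theorem eval_smul_of_isHomogeneous {f : MvPolynomial σ F} {d : ℕ} (hf : f.IsHomogeneous d) (r : F)
    (x : σ → F) :
    MvPolynomial.eval (fun s => r * x s) f = r ^ d * MvPolynomial.eval x f := by
  rw [MvPolynomial.eval_eq, MvPolynomial.eval_eq, Finset.mul_sum]
  refine Finset.sum_congr rfl fun m hm => ?_
  have h1 : ∑ i ∈ m.support, m i = d := (hf.degree_eq_sum_deg_support hm).symm
  simp only [mul_pow, Finset.prod_mul_distrib, Finset.prod_pow_eq_pow_sum, h1]
  ring

theorem eval_rep_eq_zero_iff (b : Basis σ F V) {f : MvPolynomial σ F} {d : ℕ}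
    (hf : f.IsHomogeneous d) {p : ℙ F V} {v : V} (hp : p.submodule = Submodule.span F {v}) :
    MvPolynomial.eval (fun s => b.repr p.rep s) f = 0 ↔
      MvPolynomial.eval (fun s => b.repr v s) f = 0 := by
  rw [Projectivization.submodule_eq] at hp
  obtain ⟨z, hz⟩ := Submodule.span_singleton_eq_span_singleton.1 hp
  have h1 : (fun s => b.repr v s) = fun s => (z : F) * b.repr p.rep s := by
    ext s
    rw [← hz, Units.smul_def]
    simp
  rw [h1, eval_smul_of_isHomogeneous hf]
  simp

/-- The projective Nullstellensatz for a nonempty projective algebraic set. -/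
theorem projVanishingIdeal_projZeroLocus [IsAlgClosed F] [Finite σ] (b : Basis σ F V)
    {T : Set (MvPolynomial σ F)} (hT : ∀ f ∈ T, ∃ d, MvPolynomial.IsHomogeneous f d)
    (hne : (projZeroLocus b T).Nonempty) :
    projVanishingIdeal b (projZeroLocus b T) = (Ideal.span T).radical := by
  rw [← MvPolynomial.vanishingIdeal_zeroLocus_eq_radical (k := F) (K := F),
    MvPolynomial.zeroLocus_span]
  have : Infinite F := IsAlgClosed.instInfinite
  apply le_antisymm
  · refine Ideal.span_le.2 ?_
    rintro f ⟨⟨d, hd⟩, hf⟩ x hx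
    simp only [mem_ofPred_eq] at hx ⊢
    -- The cone vertex is where nonemptiness matters: it excludes nonzero constants from the
    -- generators.
    by_cases hx0 : x = 0
    · obtain ⟨p, hp⟩ := hne
      have h1 := eval_smul_of_isHomogeneous hd 0 (fun s => b.repr p.rep s)
      rw [hf p hp, mul_zero] at h1
      rw [hx0, ← h1]
      simp only [zero_mul]
      rfl
    · let v : V := b.repr.symm (Finsupp.equivFunOnFinite.symm x)
      have hv : (fun s => b.repr v s) = x := by
        ext s
        simp [v]
      have hv0 : v ≠ 0 := by
        rintro h0
        rw [h0] at hv
        exact hx0 (by rw [← hv]; ext; simp)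
      have hsub := Projectivization.submodule_mk (K := F) v hv0
      have h1 : Projectivization.mk F v hv0 ∈ projZeroLocus b T := fun g hg => by
        obtain ⟨d', hd'⟩ := hT g hg
        rw [eval_rep_eq_zero_iff b hd' hsub, hv]
        exact hx g hg
      have h2 := hf _ h1
      rwa [eval_rep_eq_zero_iff b hd hsub, hv] at h2
  · intro f hf
    rw [← MvPolynomial.sum_homogeneousComponent f]
    refine Ideal.sum_mem _ fun d hd => Ideal.subset_span
      ⟨⟨d, MvPolynomial.homogeneousComponent_isHomogeneous d f⟩, fun p hp => ?_⟩
    -- `q(r)` is `f` at `r` times the representative of `p`. It vanishes for all `r` in an infinite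
    -- field, hence so does each coefficient, that is, each homogeneous component at `p`.
    let q : Polynomial F := ∑ i ∈ Finset.range (f.totalDegree + 1),
      Polynomial.C (MvPolynomial.eval (fun s => b.repr p.rep s)
        (MvPolynomial.homogeneousComponent i f)) * Polynomial.X ^ i
    have hq : q = 0 := by
      refine Polynomial.funext fun r => ?_
      have h1 := hf (fun s => r * b.repr p.rep s) (by
        intro g hg
        obtain ⟨d', hd'⟩ := hT g hg
        change MvPolynomial.eval _ _ = 0
        rw [eval_smul_of_isHomogeneous hd', hp g hg, mul_zero])
      change MvPolynomial.eval _ _ = 0 at h1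
      rw [Polynomial.eval_zero, ← h1]
      conv_rhs => rw [← MvPolynomial.sum_homogeneousComponent f]
      simp only [q, Polynomial.eval_finsetSum, map_sum]
      refine Finset.sum_congr rfl fun i _ => ?_
      rw [eval_smul_of_isHomogeneous (MvPolynomial.homogeneousComponent_isHomogeneous i f),
        Polynomial.eval_mul, Polynomial.eval_C, Polynomial.eval_pow, Polynomial.eval_X, mul_comm]
    have h2 : q.coeff d = MvPolynomial.eval (fun s => b.repr p.rep s)
        (MvPolynomial.homogeneousComponent d f) := by
      simp only [q, Polynomial.finsetSum_coeff, Polynomial.coeff_C_mul_X_pow]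
      rw [Finset.sum_ite_eq, if_pos hd]
    rw [← h2, hq, Polynomial.coeff_zero]

theorem isHomogeneous_pluckerVar {n m : ℕ} (c : Fin n → Fin m) :
    (pluckerVar F c).IsHomogeneous 1 := by
  rw [pluckerVar]
  split_ifs
  · exact MvPolynomial.isHomogeneous_C_mul_X _ _
  · exact MvPolynomial.isHomogeneous_zero _ _ _

theorem isHomogeneous_of_mem_pluckerRels {n m : ℕ}
    {f : MvPolynomial (powersetCard (Fin m) n) F} (hf : f ∈ pluckerRels F n m) :
    f.IsHomogeneous 2 := by
  obtain ⟨k, h, α, β, rfl⟩ := hf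
  refine MvPolynomial.IsHomogeneous.sum _ _ _ fun i _ => ?_
  have h1 : ((-1) ^ ((i : ℕ) + 1) : MvPolynomial (powersetCard (Fin m) n) F).IsHomogeneous 0 := by
    simpa using ((MvPolynomial.isHomogeneous_one (powersetCard (Fin m) n) F).neg).pow ((i : ℕ) + 1)
  exact (h1.mul (isHomogeneous_pluckerVar _)).mul (isHomogeneous_pluckerVar _)

theorem isHomogeneous_of_mem_contractionForms {n : ℕ}
    {f : MvPolynomial (powersetCard (Fin (2 * n)) n) F} (hf : f ∈ contractionForms F n) :
    f.IsHomogeneous 1 := by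
  obtain ⟨k, h, α, rfl⟩ := hf
  refine MvPolynomial.IsHomogeneous.sum _ _ _ fun i _ => ?_
  split_ifs
  · rw [one_mul]
    exact isHomogeneous_pluckerVar _
  · rw [zero_mul]
    exact MvPolynomial.isHomogeneous_zero _ _ _

end Homogeneous

/-! ### Equations and irreducibility of the Lagrangian-Grassmannian -/

section Lagrangian

variable {F E : Type*} [Field F] [AddCommGroup E] [Module F E]

theorem ιMulti_ne_zero_iff {n : ℕ} {w : Fin n → E} :
    exteriorPower.ιMulti F n w ≠ 0 ↔ LinearIndependent F w := by
  constructor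
  · intro h
    by_contra hw
    exact h (AlternatingMap.map_linearDependent _ _ hw)
  · intro hw
    have h1 := (exteriorPower.ιMulti_family_linearIndependent_field (n := n) hw).ne_zero
      (powersetCard.ofFinEmbEquiv (RelEmbedding.refl _))
    rw [exteriorPower.ιMulti_family, Equiv.symm_apply_apply] at h1
    exact h1

theorem mem_lagrangianGrassmannian_iff {n : ℕ} {B : LinearMap.BilinForm F E}
    {p : ℙ F (⋀[F]^n E)} :
    p ∈ lagrangianGrassmannian B n ↔ ∃ w : Fin n → E, LinearIndependent F w ∧
      (∀ s t, B (w s) (w t) = 0) ∧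
        p.submodule = Submodule.span F {exteriorPower.ιMulti F n w} := by
  constructor
  · rintro ⟨W, ⟨_, hW⟩, w, hp⟩
    exact ⟨fun i => w i, w.linearIndependent.map' W.subtype (Submodule.ker_subtype W),
      fun s t => hW _ (w s).2 _ (w t).2, hp⟩
  · rintro ⟨w, hw, hB, hp⟩
    refine ⟨Submodule.span F (range w), ⟨by simp [finrank_span_eq_card hw], ?_⟩, Basis.span hw, ?_⟩
    · intro u hu v hv
      induction hu using Submodule.span_induction with
      | mem x hx =>
        obtain ⟨s, rfl⟩ := hx
        induction hv using Submodule.span_induction with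
        | mem y hy =>
          obtain ⟨t, rfl⟩ := hy
          exact hB s t
        | zero => simp
        | add _ _ _ _ h1 h2 => rw [map_add, h1, h2, add_zero]
        | smul _ _ _ h1 => rw [map_smul, h1, smul_zero]
      | zero => simp
      | add _ _ _ _ h1 h2 => rw [map_add, LinearMap.add_apply, h1, h2, add_zero]
      | smul _ _ _ h1 => rw [map_smul, LinearMap.smul_apply, h1, smul_zero]
    · simp only [Basis.span_apply]
      exact hp

/-- The Lagrangian-Grassmannian is cut out by the Plücker relations and the linear forms `Π_γ`. -/
theorem lagrangianGrassmannian_eq_projZeroLocus {n : ℕ} (hn : 2 ≤ n) {B : LinearMap.BilinForm F E}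
    (hB : B.IsAlt) {e : Basis (Fin (2 * n)) F E} (he : IsSymplecticBasis B e) :
    lagrangianGrassmannian B n =
      projZeroLocus (e.exteriorPower n) (pluckerRels F n (2 * n) ∪ contractionForms F n) := by
  obtain ⟨k, rfl⟩ : ∃ k, n = k + 1 := ⟨n - 1, by omega⟩
  ext p
  rw [mem_lagrangianGrassmannian_iff]
  constructor
  · rintro ⟨w, hw, hBw, hp⟩ f (hf | hf)
    · rw [eval_rep_eq_zero_iff _ (isHomogeneous_of_mem_pluckerRels hf) hp]
      exact (pluckerRels_eval_eq_zero_iff e (ιMulti_ne_zero_iff.2 hw)).2 ⟨w, rfl⟩ f hf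
    · rw [eval_rep_eq_zero_iff _ (isHomogeneous_of_mem_contractionForms hf) hp]
      exact (contractionForms_eval_eq_zero_iff hn hB he hw).2 hBw f hf
  · intro h
    obtain ⟨w, hw⟩ := (pluckerRels_eval_eq_zero_iff e p.rep_nonzero).1 fun f hf => h f (Or.inl hf)
    have hli : LinearIndependent F w := ιMulti_ne_zero_iff.1 (hw ▸ p.rep_nonzero)
    refine ⟨w, hli, (contractionForms_eval_eq_zero_iff hn hB he hli).1 fun f hf => ?_, ?_⟩
    · rw [← hw]
      exact h f (Or.inr hf)
    · rw [Projectivization.submodule_eq, hw]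

theorem lagrangianGrassmannian_nonempty {n : ℕ} {B : LinearMap.BilinForm F E}
    (hB : B.IsAlt) {e : Basis (Fin (2 * n)) F E} (he : IsSymplecticBasis B e) :
    (lagrangianGrassmannian B n).Nonempty := by
  have hli : LinearIndependent F fun i : Fin n => e (Fin.castLE (by omega) i) :=
    e.linearIndependent.comp _ (Fin.castLE_injective _)
  refine ⟨Projectivization.mk F _ (ιMulti_ne_zero_iff.2 hli),
    mem_lagrangianGrassmannian_iff.2 ⟨_, hli, fun s t => ?_, Projectivization.submodule_mk _ _⟩⟩
  rw [he.apply_eq hB]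
  refine Finset.sum_eq_zero fun i _ => ?_
  have h1 (j : Fin n) : e.coord (Fin.rev (Fin.castLE (by omega) i)) (e (Fin.castLE (by omega) j))
      = 0 := by
    rw [Basis.coord_apply, Basis.repr_self, Finsupp.single_eq_of_ne]
    intro h
    have := congrArg Fin.val h
    simp [Fin.val_rev] at this
    omega
  rw [h1, h1, mul_zero, mul_zero, sub_zero]

theorem ιMulti_sum_smul {n m : ℕ} (e : Basis (Fin m) F E) (P : Matrix (Fin n) (Fin n) F)
    (w : Fin n → E) : exteriorPower.ιMulti F n (fun i => ∑ j, P i j • w j) =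
      P.det • exteriorPower.ιMulti F n w := by
  refine eq_of_pluckerForm_eq e (AlternatingMap.ext fun c => ?_)
  rw [pluckerForm_smul, pluckerForm_ιMulti, pluckerForm_ιMulti, AlternatingMap.smul_apply,
    detForm_apply, detForm_apply, smul_eq_mul, ← Matrix.det_mul]
  congr 1
  ext i j
  simp [Matrix.mul_apply]

/-- A square matrix becomes symmetric after multiplication by an invertible matrix. -/
theorem exists_mul_transpose_isSymm {n : ℕ} (M : Matrix (Fin n) (Fin n) F) :
    ∃ P : Matrix (Fin n) (Fin n) F, P.det ≠ 0 ∧ (M * P.transpose).IsSymm := by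
  obtain ⟨L, L', D, hM⟩ := Matrix.Pivot.exists_list_transvec_mul_diagonal_mul_list_transvec M
  set A := (L.map Matrix.TransvectionStruct.toMatrix).prod with hA
  set C := (L'.map Matrix.TransvectionStruct.toMatrix).prod with hC
  have hA1 : A.det = 1 := Matrix.TransvectionStruct.det_toMatrix_prod L
  have hC1 : C.det = 1 := Matrix.TransvectionStruct.det_toMatrix_prod L'
  have hCu : IsUnit C.det := by simp [hC1]
  -- With `M = A D C`, this choice gives `M Pᵀ = A D Aᵀ`.
  refine ⟨A * C⁻¹.transpose, by simp [hA1, hC1], ?_⟩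
  rw [hM, Matrix.transpose_mul, Matrix.transpose_transpose, ← mul_assoc, mul_assoc _ C,
    Matrix.mul_nonsing_inv _ hCu, mul_one]
  simp [Matrix.IsSymm, Matrix.transpose_mul, mul_assoc]

/-- A polynomial evaluated along the exterior products of lines `(1 - t) uᵢ + t vᵢ` is polynomial
in `t`. -/
theorem exists_polynomial_eval_ιMulti {n m : ℕ} (e : Basis (Fin m) F E) (u v : Fin n → E)
    (f : MvPolynomial (powersetCard (Fin m) n) F) :
    ∃ q : Polynomial F, ∀ t, q.eval t = MvPolynomial.eval (fun s => (e.exteriorPower n).repr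
      (exteriorPower.ιMulti F n fun i => (1 - t) • u i + t • v i) s) f := by
  -- The Plücker coordinates are minors of a matrix whose entries are affine-linear in `t`.
  let g : powersetCard (Fin m) n → Polynomial F := fun s => Matrix.det (Matrix.of fun i j =>
    (1 - Polynomial.X) * Polynomial.C (e.coord (powersetCard.ofFinEmbEquiv.symm s j) (u i)) +
      Polynomial.X * Polynomial.C (e.coord (powersetCard.ofFinEmbEquiv.symm s j) (v i)))
  refine ⟨MvPolynomial.aeval g f, fun t => ?_⟩
  have h1 (s) : (g s).eval t = (e.exteriorPower n).repr
      (exteriorPower.ιMulti F n fun i => (1 - t) • u i + t • v i) s := by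
    rw [exteriorPower.basis_repr_apply, exteriorPower.ιMultiDual_apply_ιMulti,
      ← Polynomial.coe_evalRingHom, RingHom.map_det]
    congr 1
    ext i j
    simp
    ring
  rw [← MvPolynomial.coe_aeval_eq_eval, ← Polynomial.coe_aeval_eq_eval]
  simp only [← h1]
  have h2 := DFunLike.congr_fun (MvPolynomial.comp_aeval g (Polynomial.aeval (R := F) t)) f
  simpa using h2

/-- Any two Lagrangian subspaces lie on a rational curve of Lagrangian subspaces. -/
theorem exists_eval_ne_zero_of_lagrangian [Infinite F] {n m : ℕ} {B : LinearMap.BilinForm F E}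
    (hB : B.IsAlt) (e : Basis (Fin m) F E) {u v : Fin n → E}
    (hu : LinearIndependent F u) (hBu : ∀ s t, B (u s) (u t) = 0)
    (hBv : ∀ s t, B (v s) (v t) = 0)
    {f g : MvPolynomial (powersetCard (Fin m) n) F} {d : ℕ} (hg : g.IsHomogeneous d)
    (hfu : MvPolynomial.eval
      (fun s => (e.exteriorPower n).repr (exteriorPower.ιMulti F n u) s) f ≠ 0)
    (hgv : MvPolynomial.eval
      (fun s => (e.exteriorPower n).repr (exteriorPower.ιMulti F n v) s) g ≠ 0) :
    ∃ w : Fin n → E, LinearIndependent F w ∧ (∀ s t, B (w s) (w t) = 0) ∧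
      MvPolynomial.eval
        (fun s => (e.exteriorPower n).repr (exteriorPower.ιMulti F n w) s) f ≠ 0 ∧
      MvPolynomial.eval
        (fun s => (e.exteriorPower n).repr (exteriorPower.ιMulti F n w) s) g ≠ 0 := by
  obtain ⟨P, hP, hS⟩ := exists_mul_transpose_isSymm (Matrix.of fun i j => B (u i) (v j))
  let v' : Fin n → E := fun i => ∑ j, P i j • v j
  have huv (i j) : B (u i) (v' j) = B (u j) (v' i) := by
    have h1 (i j) : B (u i) (v' j) =
        ((Matrix.of fun i j => B (u i) (v j)) * P.transpose) i j := by
      simp [v', Matrix.mul_apply, mul_comm]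
    rw [h1, h1, ← hS.apply]
  have hBv' (i j) : B (v' i) (v' j) = 0 := by
    simp [v', hBv]
  have hgv' : MvPolynomial.eval
      (fun s => (e.exteriorPower n).repr (exteriorPower.ιMulti F n v') s) g ≠ 0 := by
    have h1 : (fun s => (e.exteriorPower n).repr (exteriorPower.ιMulti F n v') s) =
        fun s => P.det * (e.exteriorPower n).repr (exteriorPower.ιMulti F n v) s := by
      ext s
      simp only [v']
      rw [ιMulti_sum_smul e]
      simp
    rw [h1, eval_smul_of_isHomogeneous hg]
    exact mul_ne_zero (pow_ne_zero _ hP) hgv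
  obtain ⟨s, hs⟩ : ∃ s, (e.exteriorPower n).repr (exteriorPower.ιMulti F n u) s ≠ 0 := by
    by_contra! H
    refine ιMulti_ne_zero_iff.2 hu ((e.exteriorPower n).repr.injective (Finsupp.ext fun s => ?_))
    simp [H]
  obtain ⟨q₁, h₁⟩ := exists_polynomial_eval_ιMulti e u v' f
  obtain ⟨q₂, h₂⟩ := exists_polynomial_eval_ιMulti e u v' g
  -- A Plücker coordinate nonzero at `u`; keeping it nonzero keeps the family independent.
  obtain ⟨q₃, h₃⟩ := exists_polynomial_eval_ιMulti e u v' (MvPolynomial.X s)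
  have hq₁ : q₁ ≠ 0 := by
    rintro rfl
    have := h₁ 0
    simp only [sub_zero, one_smul, zero_smul, add_zero, Polynomial.eval_zero] at this
    exact hfu this.symm
  have hq₂ : q₂ ≠ 0 := by
    rintro rfl
    have := h₂ 1
    simp only [sub_self, one_smul, zero_smul, zero_add, Polynomial.eval_zero] at this
    exact hgv' this.symm
  have hq₃ : q₃ ≠ 0 := by
    rintro rfl
    have := h₃ 0
    simp only [sub_zero, one_smul, zero_smul, add_zero, Polynomial.eval_zero,
      MvPolynomial.eval_X] at this
    exact hs this.symm
  obtain ⟨t, ht⟩ : ∃ t, (q₁ * q₂ * q₃).eval t ≠ 0 := by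
    by_contra! H
    exact mul_ne_zero (mul_ne_zero hq₁ hq₂) hq₃ (Polynomial.funext fun t => by simp [H])
  rw [Polynomial.eval_mul, Polynomial.eval_mul, h₁, h₂, h₃, MvPolynomial.eval_X] at ht
  refine ⟨fun i => (1 - t) • u i + t • v' i, ιMulti_ne_zero_iff.1 ?_, fun i j => ?_,
    left_ne_zero_of_mul (left_ne_zero_of_mul ht), right_ne_zero_of_mul (left_ne_zero_of_mul ht)⟩
  · intro h0
    rw [h0] at ht
    simp at ht
  · have h1 : B (v' i) (u j) = - B (u i) (v' j) := by rw [← hB.neg_eq, huv]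
    simp only [map_add, map_smul, LinearMap.add_apply, LinearMap.smul_apply, smul_eq_mul, hBu,
      hBv', h1]
    ring

end Lagrangian

end LagrangianGrassmannian

end

theorem mainTheorem6 {F E : Type*} [Field F] [IsAlgClosed F] [AddCommGroup E] [Module F E]
    (n : ℕ) (hn : 2 ≤ n) (B : LinearMap.BilinForm F E)
    (hB : LagrangianGrassmannian.IsSymplecticForm B)
    (e : Module.Basis (Fin (2 * n)) F E)
    (he : LagrangianGrassmannian.IsSymplecticBasis B e) :
    LagrangianGrassmannian.projVanishingIdeal (e.exteriorPower n)
        (LagrangianGrassmannian.lagrangianGrassmannian B n) =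
      (Ideal.span (LagrangianGrassmannian.pluckerRels F n (2 * n) ∪
        LagrangianGrassmannian.contractionForms F n)).radical ∧
    LagrangianGrassmannian.IsProjVariety (e.exteriorPower n)
      (LagrangianGrassmannian.lagrangianGrassmannian B n) := by
  open LagrangianGrassmannian in
  have : Infinite F := IsAlgClosed.instInfinite
  have hLG := lagrangianGrassmannian_eq_projZeroLocus hn hB.1 he
  have hne := lagrangianGrassmannian_nonempty hB.1 he
  have hT : ∀ f ∈ pluckerRels F n (2 * n) ∪ contractionForms F n,
      ∃ d, MvPolynomial.IsHomogeneous f d := by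
    rintro f (hf | hf)
    exacts [⟨2, isHomogeneous_of_mem_pluckerRels hf⟩, ⟨1, isHomogeneous_of_mem_contractionForms hf⟩]
  refine ⟨?_, ⟨_, hT, hLG⟩, hne, ?_⟩
  · rw [hLG] at hne ⊢
    exact projVanishingIdeal_projZeroLocus _ hT hne
  · rintro _ _ ⟨T₁, hT₁, rfl⟩ ⟨T₂, hT₂, rfl⟩ hsub
    by_contra! H
    obtain ⟨⟨p, hp, hp'⟩, ⟨q, hq, hq'⟩⟩ := And.imp Set.not_subset.1 Set.not_subset.1 H
    simp only [projZeroLocus, Set.mem_ofPred_eq, not_forall] at hp' hq'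
    obtain ⟨f, hf, hfp⟩ := hp'
    obtain ⟨g, hg, hgq⟩ := hq'
    obtain ⟨d₁, hd₁⟩ := hT₁ f hf
    obtain ⟨d₂, hd₂⟩ := hT₂ g hg
    obtain ⟨u, hu, hBu, hpu⟩ := mem_lagrangianGrassmannian_iff.1 hp
    obtain ⟨v, -, hBv, hqv⟩ := mem_lagrangianGrassmannian_iff.1 hq
    rw [eval_rep_eq_zero_iff _ hd₁ hpu] at hfp
    rw [eval_rep_eq_zero_iff _ hd₂ hqv] at hgq
    obtain ⟨w, hw, hBw, hfw, hgw⟩ :=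
      exists_eval_ne_zero_of_lagrangian hB.1 e hu hBu hBv hd₂ hfp hgq
    have hsm := Projectivization.submodule_mk (K := F) _ (ιMulti_ne_zero_iff.2 hw)
    rcases hsub (mem_lagrangianGrassmannian_iff.2 ⟨w, hw, hBw, hsm⟩) with h | h
    · exact hfw ((eval_rep_eq_zero_iff _ hd₁ hsm).1 (h f hf))
    · exact hgw ((eval_rep_eq_zero_iff _ hd₂ hsm).1 (h g hg))
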